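/- Setting. Let $0<\mu<L$, $d\in\mathbb N$, and let $f:\mathbb R^d\to\mathbb R$ be $\mu$-strongly convex and continuously differentiable with $L$-Lipschitz gradient; let $x_*$ be its minimizer and $f_*=f(x_*)$. Let $\alpha>0$, $\beta,\nu\ge 0$. For a deterministic $x_0=x_{-1}\in\mathbb R^d$ and random errors $w_1,w_2,\dots$ in $\mathbb R^d$, consider the noisy generalized momentum method $$y_k=x_k+\nu(x_k-x_{k-1}),\qquad x_{k+1}=x_k-\alpha\big(\nabla f(y_k)+w_{k+1}\big)+\beta(x_k-x_{k-1}),\qquad k\ge 0 .$$ Let $(\mathcal F_k)_{k\ge0}$ be a filtration (for instance the one generated by the iterates) such that $w_{k+1}$ is $\mathcal F_{k+1}$-measurable, and let $\sigma>0$ be such that, almost surely, $\mathbb P(\|w_{k+1}\|\ge t\mid\mathcal F_k)\le 2e^{-t^2/(2\sigma^2)}$ for all $k\ge 0$ and $t\ge 0$ (the errors may be biased). For $\theta>0$ put $$R_K(\theta)=\frac{2\sigma^2}{(K+1)\theta}\log\mathbb E\Big[e^{\frac{\theta}{2\sigma^2}S_K}\Big]\in(-\infty,+\infty],\qquad S_K=\sum_{k=0}^K\big(f(x_k)-f_*\big).$$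 Matrix inequality. Put $\tilde A=\begin{bmatrix}1+\beta&-\beta\\1&0\end{bmatrix}$, $\tilde B=\begin{bmatrix}-\alpha\\0\end{bmatrix}$, $\tilde C=\begin{bmatrix}1+\nu&-\nu\end{bmatrix}$, $\tilde\Delta=\beta-\nu$. For scalars $\rho_0,\rho_1,\rho_2,\rho_3\in[0,1)$, $a,b,c_0,c_1\ge 0$ and a symmetric positive semidefinite $\tilde P\in\mathbb R^{2\times2}$ let $$p=\rho_0^2+c_1\rho_1^2+\rho_2^2+\tfrac{4b(1+\nu)^2L^2}{\mu}c_1,\quad q=\rho_3^2+\tfrac{4b\nu^2L^2}{\mu}c_1,\quad r=a+\alpha^2\big(\tfrac{c_1L}{2}+\tilde P_{11}\big),$$ $\tilde r=\tilde P_{11}-\tilde P_{12}^2/\tilde P_{22}$ if $\tilde P_{22}\ne0$ and $\tilde r=\tilde P_{11}$ otherwise, $c=c_1+\frac2L\tilde r$, and define the symmetric $4\times4$ matrices $$\tilde M_0=\begin{bmatrix}2\mu L\tilde C^\top\tilde C&-(\mu+L)\tilde C^\top&0\\-(\mu+L)\tilde C&2&0\\0&0&0\end{bmatrix},\qquad \tilde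 M_1=\begin{bmatrix}\tilde X+\tilde Z&\tilde v\\ \tilde v^\top&0\end{bmatrix},\quad \tilde v=\tfrac{\alpha}{2}\begin{bmatrix}L\tilde\Delta\\-L\tilde\Delta\\1-L\alpha\end{bmatrix},$$ $$\tilde M_2=\begin{bmatrix}-\tilde A^\top\tilde P\tilde A+\rho_0^2\tilde P&-\tilde A^\top\tilde P\tilde B&-\tilde A^\top\tilde P\tilde B\\-\tilde B^\top\tilde P\tilde A&-\tilde B^\top\tilde P\tilde B+b\,c_1^2&-\tilde B^\top\tilde P\tilde B\\-\tilde B^\top\tilde P\tilde A&-\tilde B^\top\tilde P\tilde B&a\end{bmatrix},$$ where $\tilde X=\tilde X_1+\rho_0^2\tilde X_2+(1-\rho_0^2)\tilde X_3$, $$\tilde X_1=\tfrac12\begin{bmatrix}-L\tilde\Delta^2&L\tilde\Delta^2&-(1-\alpha L)\tilde\Delta\\L\tilde\Delta^2&-L\tilde\Delta^2&(1-\alpha L)\tilde\Delta\\-(1-\alpha L)\tilde\Delta&(1-\alpha L)\tilde\Delta&\alpha(2-L\alpha)\end{bmatrix},\quad \tilde X_2=\tfrac12\begin{bmatrix}\nu^2\mu&-\nu^2\mu&-\nu\\-\nu^2\mu&\nu^2\mu&\nu\\-\nu&\nu&0\end{bmatrix},$$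 $$\tilde X_3=\tfrac12\begin{bmatrix}(1+\nu)^2\mu&-\nu(1+\nu)\mu&-(1+\nu)\\-\nu(1+\nu)\mu&\nu^2\mu&\nu\\-(1+\nu)&\nu&0\end{bmatrix},\quad \tilde Z=\begin{bmatrix}\rho_1^2\tilde P_{11}+\frac\mu2\rho_2^2&\rho_1^2\tilde P_{12}&0\\\rho_1^2\tilde P_{12}&\rho_1^2\tilde P_{22}+\frac\mu2\rho_3^2&0\\0&0&0\end{bmatrix}.$$ Assume that $p+q<1$, $c>0$, $c_1+\tilde P_{11}>0$ and $\tilde M_2+c_1\tilde M_1+c_0\tilde M_0\succeq0$. Put $$\overline H_\infty=\Big(\frac{1}{1-(p+q)}\cdot\frac{r}{c}\Big)^{1/2},\qquad \lambda_+=\frac{p+\sqrt{p^2+4q}}{2},\qquad J_{p,q}=\frac1{1+\lambda_+-p},$$ $$V_0=c_1\big(f(x_0)-f_*\big)+\begin{bmatrix}x_0-x_*\\x_0-x_*\end{bmatrix}^\top(\tilde P\otimes I_d)\begin{bmatrix}x_0-x_*\\x_0-x_*\end{bmatrix},\qquad a_{j,K}=\frac{1-\lambda_+^{K-j+1}}{1-(p+q)}\quad(1\le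 j\le K),$$ $$\hat c(K,\theta)=\begin{cases}\dfrac{2\sigma^2c}{\theta}\displaystyle\sum_{j=1}^K\log\frac{c+r\theta a_{j,K}}{c-r\theta a_{j,K}},&\sqrt\theta\,\overline H_\infty<1,\\+\infty,&\text{otherwise,}\end{cases}\qquad \bar c(K,\theta)=\Big(\frac{1-\lambda_+^{K+1}}{1-\lambda_+}-1+J_{p,q}\Big)V_0+\hat c(K,\theta).$$ Theorem. Under these assumptions $\lambda_+\in[0,1)$, $J_{p,q}\in(0,1]$, and for every $K\ge1$ and every $\theta>0$ one has $R_K(\theta)\le\overline R_K(\theta)$, where $$\overline R_K(\theta)=\begin{cases}\dfrac{1}{c\,(K+1)}\min\Big\{\dfrac1{J_{p,q}}\,\bar c\Big(K,\dfrac{\theta}{J_{p,q}}\Big),\ \bar c(K+1,\theta)\Big\},&\sqrt\theta\,\overline H_\infty<1,\\+\infty,&\text{otherwise.}\end{cases}$$ In particular, $R_K(\theta)$ is finite whenever $\sqrt\theta\,\overline H_\infty<1$. -/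

import Mathlib

open MeasureTheory ProbabilityTheory
open scoped Kronecker Matrix

noncomputable section

namespace GMM

/-- The class of `μ`-strongly convex and `L`-smooth functions on `ℝ^d`. -/
structure StronglyConvexSmooth {d : ℕ} (μ L : ℝ) (f : EuclideanSpace ℝ (Fin d) → ℝ) : Prop where
  strongConvex : StrongConvexOn Set.univ μ f
  contDiff : ContDiff ℝ 1 f
  lipschitz_gradient : ∀ x y, ‖gradient f x - gradient f y‖ ≤ L * ‖x - y‖

/-- The noisy generalized momentum method along a noise path `w`: the pair `(x_k, x_{k-1})`,
with `x_{-1} = x_0`, where `y_k = x_k + ν (x_k - x_{k-1})` and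
`x_{k+1} = x_k - α (∇f(y_k) + w_{k+1}) + β (x_k - x_{k-1})`. The entry `w 0` is not used. -/
def state {d : ℕ} (α β ν : ℝ) (f : EuclideanSpace ℝ (Fin d) → ℝ)
    (x₀ : EuclideanSpace ℝ (Fin d)) (w : ℕ → EuclideanSpace ℝ (Fin d)) :
    ℕ → EuclideanSpace ℝ (Fin d) × EuclideanSpace ℝ (Fin d)
  | 0 => (x₀, x₀)
  | k + 1 =>
    let x := (state α β ν f x₀ w k).1
    let xprev := (state α β ν f x₀ w k).2
    let y := x + ν • (x - xprev)
    (x - α • (gradient f y + w (k + 1)) + β • (x - xprev), x)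

/-- The iterate `x_k`. -/
def iterate {d : ℕ} (α β ν : ℝ) (f : EuclideanSpace ℝ (Fin d) → ℝ)
    (x₀ : EuclideanSpace ℝ (Fin d)) (w : ℕ → EuclideanSpace ℝ (Fin d)) (k : ℕ) :
    EuclideanSpace ℝ (Fin d) :=
  (state α β ν f x₀ w k).1

/-- Cumulative suboptimality `S_K = ∑_{k=0}^K (f(x_k) - f_*)` of a sequence of points. -/
def cumSubopt {d : ℕ} (f : EuclideanSpace ℝ (Fin d) → ℝ) (xstar : EuclideanSpace ℝ (Fin d))
    (x : ℕ → EuclideanSpace ℝ (Fin d)) (K : ℕ) : ℝ :=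
  ∑ k ∈ Finset.range (K + 1), (f (x k) - f xstar)

/-- The risk-sensitive cost `(2σ² / ((K+1) θ)) log E[exp(θ S / (2σ²))]` of a random cumulative
cost `S`, in the extended reals: it is `+∞` when the expectation is infinite. -/
def riskCost {Ω : Type*} [MeasurableSpace Ω] (Pr : Measure Ω) (σ : ℝ) (S : Ω → ℝ) (K : ℕ)
    (θ : ℝ) : EReal :=
  ((2 * σ ^ 2 / (((K : ℝ) + 1) * θ) : ℝ) : EReal) *
    ENNReal.log (∫⁻ ω, ENNReal.ofReal (Real.exp (θ / (2 * σ ^ 2) * S ω)) ∂Pr)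

/-- The noise `w_{k+1}` is adapted, and conditionally on `ℱ_k` its norm is sub-Gaussian with
variance proxy `σ²`; no conditional mean is prescribed, so the noise may be biased. -/
structure SubGaussianNoise {Ω : Type*} {m : MeasurableSpace Ω} (Pr : Measure Ω) {d : ℕ}
    (ℱ : Filtration ℕ m) (σ : ℝ) (w : ℕ → Ω → EuclideanSpace ℝ (Fin d)) : Prop where
  adapted : ∀ k, Measurable[ℱ (k + 1)] (w (k + 1))
  tail : ∀ k, ∀ t : ℝ, 0 ≤ t →
    ∀ᵐ ω ∂Pr, (Pr⟦{ω' | t ≤ ‖w (k + 1) ω'‖} | ℱ k⟧) ω ≤ 2 * Real.exp (-t ^ 2 / (2 * σ ^ 2))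

/-- The scalars that enter the matrix inequality (pure data, no conditions):
problem constants `μ, L`, algorithm parameters `α, β, ν`, multipliers, and the matrix `P̃`. -/
structure Params where
  (μ L α β ν ρ₀ ρ₁ ρ₂ ρ₃ a b c₀ c₁ : ℝ)
  P : Matrix (Fin 2) (Fin 2) ℝ

namespace Params

variable (c : Params)

def Amat : Matrix (Fin 2) (Fin 2) ℝ := !![1 + c.β, -c.β; 1, 0]

def Bmat : Matrix (Fin 2) (Fin 1) ℝ := !![-c.α; 0]

def Cmat : Matrix (Fin 1) (Fin 2) ℝ := !![1 + c.ν, -c.ν]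

/-- `Δ̃ = β - ν`. -/
def Δ : ℝ := c.β - c.ν

def X₁ : Matrix (Fin 3) (Fin 3) ℝ :=
  (1 / 2 : ℝ) •
    !![-c.L * c.Δ ^ 2, c.L * c.Δ ^ 2, -(1 - c.α * c.L) * c.Δ;
       c.L * c.Δ ^ 2, -c.L * c.Δ ^ 2, (1 - c.L * c.α) * c.Δ;
       -(1 - c.α * c.L) * c.Δ, (1 - c.L * c.α) * c.Δ, c.α * (2 - c.L * c.α)]

def X₂ : Matrix (Fin 3) (Fin 3) ℝ :=
  (1 / 2 : ℝ) •
    !![c.ν ^ 2 * c.μ, -c.ν ^ 2 * c.μ, -c.ν;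
       -c.ν ^ 2 * c.μ, c.ν ^ 2 * c.μ, c.ν;
       -c.ν, c.ν, 0]

def X₃ : Matrix (Fin 3) (Fin 3) ℝ :=
  (1 / 2 : ℝ) •
    !![(1 + c.ν) ^ 2 * c.μ, -c.ν * (1 + c.ν) * c.μ, -(1 + c.ν);
       -c.ν * (1 + c.ν) * c.μ, c.ν ^ 2 * c.μ, c.ν;
       -(1 + c.ν), c.ν, 0]

def X : Matrix (Fin 3) (Fin 3) ℝ :=
  c.X₁ + c.ρ₀ ^ 2 • c.X₂ + (1 - c.ρ₀ ^ 2) • c.X₃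

def Z : Matrix (Fin 3) (Fin 3) ℝ :=
  !![c.ρ₁ ^ 2 * c.P 0 0 + c.μ / 2 * c.ρ₂ ^ 2, c.ρ₁ ^ 2 * c.P 0 1, 0;
     c.ρ₁ ^ 2 * c.P 0 1, c.ρ₁ ^ 2 * c.P 1 1 + c.μ / 2 * c.ρ₃ ^ 2, 0;
     0, 0, 0]

/-- `[[2μL C̃ᵀC̃, -(μ+L)C̃ᵀ, 0], [-(μ+L)C̃, 2, 0], [0, 0, 0]]`. -/
def M₀ : Matrix (Fin 4) (Fin 4) ℝ :=
  let CC := c.Cmatᵀ * c.Cmat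
  !![2 * c.μ * c.L * CC 0 0, 2 * c.μ * c.L * CC 0 1, -(c.μ + c.L) * c.Cmat 0 0, 0;
     2 * c.μ * c.L * CC 1 0, 2 * c.μ * c.L * CC 1 1, -(c.μ + c.L) * c.Cmat 0 1, 0;
     -(c.μ + c.L) * c.Cmat 0 0, -(c.μ + c.L) * c.Cmat 0 1, 2, 0;
     0, 0, 0, 0]

/-- `X̃ + Z̃`, bordered by the column
`(Lα(β-ν)/2, -Lα(β-ν)/2, α(1-Lα)/2)` and its transpose, with corner `0`. -/
def M₁ : Matrix (Fin 4) (Fin 4) ℝ :=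
  let Y := c.X + c.Z
  let u := c.L * c.α * (c.β - c.ν) / 2
  let v := c.α * (1 - c.L * c.α) / 2
  !![Y 0 0, Y 0 1, Y 0 2, u;
     Y 1 0, Y 1 1, Y 1 2, -u;
     Y 2 0, Y 2 1, Y 2 2, v;
     u, -u, v, 0]

/-- `[[-ÃᵀP̃Ã + ρ₀²P̃, -ÃᵀP̃B̃, -ÃᵀP̃B̃], [-B̃ᵀP̃Ã, -B̃ᵀP̃B̃ + b c₁², -B̃ᵀP̃B̃],
[-B̃ᵀP̃Ã, -B̃ᵀP̃B̃, a]]`. -/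
def M₂ : Matrix (Fin 4) (Fin 4) ℝ :=
  let APA := c.Amatᵀ * c.P * c.Amat
  let APB := c.Amatᵀ * c.P * c.Bmat
  let BPA := c.Bmatᵀ * c.P * c.Amat
  let BPB := c.Bmatᵀ * c.P * c.Bmat
  !![-APA 0 0 + c.ρ₀ ^ 2 * c.P 0 0, -APA 0 1 + c.ρ₀ ^ 2 * c.P 0 1, -APB 0 0, -APB 0 0;
     -APA 1 0 + c.ρ₀ ^ 2 * c.P 1 0, -APA 1 1 + c.ρ₀ ^ 2 * c.P 1 1, -APB 1 0, -APB 1 0;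
     -BPA 0 0, -BPA 0 1, -BPB 0 0 + c.b * c.c₁ ^ 2, -BPB 0 0;
     -BPA 0 0, -BPA 0 1, -BPB 0 0, c.a]

def p : ℝ :=
  c.ρ₀ ^ 2 + c.c₁ * c.ρ₁ ^ 2 + c.ρ₂ ^ 2 + 4 * c.b * (1 + c.ν) ^ 2 * c.L ^ 2 / c.μ * c.c₁

def q : ℝ := c.ρ₃ ^ 2 + 4 * c.b * c.ν ^ 2 * c.L ^ 2 / c.μ * c.c₁

def r : ℝ := c.a + c.α ^ 2 * (c.c₁ * c.L / 2 + c.P 0 0)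

/-- `r̃(P̃)`. -/
def rTilde : ℝ := if c.P 1 1 ≠ 0 then c.P 0 0 - c.P 0 1 ^ 2 / c.P 1 1 else c.P 0 0

/-- `c₁ + (2/L) r̃(P̃)`. -/
def lyapConst : ℝ := c.c₁ + 2 / c.L * c.rTilde

/-- The bound `H̄∞ = ((1/(1-(p+q))) · r/(c₁ + (2/L) r̃(P̃)))^{1/2}`. -/
def HBar : ℝ := Real.sqrt (1 / (1 - (c.p + c.q)) * (c.r / c.lyapConst))

/-- `c` satisfies the sign and range conditions, `p + q < 1`, and the `4 × 4` matrix inequality. -/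
structure Feasible : Prop where
  μ_pos : 0 < c.μ
  μ_lt_L : c.μ < c.L
  α_pos : 0 < c.α
  β_nonneg : 0 ≤ c.β
  ν_nonneg : 0 ≤ c.ν
  ρ₀_mem : c.ρ₀ ∈ Set.Ico (0 : ℝ) 1
  ρ₁_mem : c.ρ₁ ∈ Set.Ico (0 : ℝ) 1
  ρ₂_mem : c.ρ₂ ∈ Set.Ico (0 : ℝ) 1
  ρ₃_mem : c.ρ₃ ∈ Set.Ico (0 : ℝ) 1
  a_nonneg : 0 ≤ c.a
  b_nonneg : 0 ≤ c.b
  c₀_nonneg : 0 ≤ c.c₀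
  c₁_nonneg : 0 ≤ c.c₁
  P_posSemidef : c.P.PosSemidef
  p_add_q_lt_one : c.p + c.q < 1
  lyapConst_pos : 0 < c.lyapConst
  c₁_add_pos : 0 < c.c₁ + c.P 0 0
  matrix_ineq : (c.M₂ + c.c₁ • c.M₁ + c.c₀ • c.M₀).PosSemidef

/-- The stacked vector `(u, v) ∈ ℝ^{2d}`. -/
def stack {d : ℕ} (u v : EuclideanSpace ℝ (Fin d)) : Fin 2 × Fin d → ℝ :=
  fun i => if i.1 = 0 then u i.2 else v i.2

/-- The Lyapunov function `V_{P,c₁}(ξ)` at `ξ = (x, x⁻)`, with `P = P̃ ⊗ I_d`. -/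
def V {d : ℕ} (f : EuclideanSpace ℝ (Fin d) → ℝ) (xstar : EuclideanSpace ℝ (Fin d))
    (ξ : EuclideanSpace ℝ (Fin d) × EuclideanSpace ℝ (Fin d)) : ℝ :=
  c.c₁ * (f ξ.1 - f xstar) +
    stack (ξ.1 - xstar) (ξ.2 - xstar) ⬝ᵥ
      ((c.P ⊗ₖ (1 : Matrix (Fin d) (Fin d) ℝ)) *ᵥ stack (ξ.1 - xstar) (ξ.2 - xstar))

/-- `λ₊ = (p + √(p² + 4q)) / 2`. -/
def lamPlus : ℝ := (c.p + Real.sqrt (c.p ^ 2 + 4 * c.q)) / 2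

/-- `J_{p,q} = 1 / (1 + λ₊ - p)`. -/
def J : ℝ := 1 / (1 + c.lamPlus - c.p)

/-- `a_{j,K} = (1 - λ₊^{K-j+1}) / (1 - (p+q))`, used for `1 ≤ j ≤ K`. -/
def aCoef (j K : ℕ) : ℝ := (1 - c.lamPlus ^ (K - j + 1)) / (1 - (c.p + c.q))

open Classical in
/-- `ĉ(K, θ)`. -/
def cHat (σ : ℝ) (K : ℕ) (θ : ℝ) : EReal :=
  if Real.sqrt θ * c.HBar < 1 then
    ((2 * σ ^ 2 * c.lyapConst / θ *
      ∑ j ∈ Finset.Icc 1 K,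
        Real.log ((c.lyapConst + c.r * θ * c.aCoef j K) /
          (c.lyapConst - c.r * θ * c.aCoef j K)) : ℝ) : EReal)
  else ⊤

/-- `c̄(K, θ)`, as a function of the value `V₀ = V_{P,c₁}(ξ₀)`. -/
def cBar (σ V₀ : ℝ) (K : ℕ) (θ : ℝ) : EReal :=
  ((((1 - c.lamPlus ^ (K + 1)) / (1 - c.lamPlus) - 1 + c.J) * V₀ : ℝ) : EReal) + c.cHat σ K θ

open Classical in
/-- The bound `R̄_K(θ)`, as a function of the value `V₀ = V_{P,c₁}(ξ₀)`. -/
def riskBound (σ V₀ : ℝ) (K : ℕ) (θ : ℝ) : EReal :=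
  if Real.sqrt θ * c.HBar < 1 then
    ((1 / (c.lyapConst * ((K : ℝ) + 1)) : ℝ) : EReal) *
      min (((1 / c.J : ℝ) : EReal) * c.cBar σ V₀ K (θ / c.J)) (c.cBar σ V₀ (K + 1) θ)
  else ⊤

end Params

end GMM

end

/-!
The bound rests on one deterministic inequality and one probabilistic one.

*Deterministic part.* Write `V_k` for the Lyapunov function at `(x_k, x_{k-1})`. Evaluating the
positive semidefinite matrix `M₂ + c₁ M₁ + c₀ M₀` on the vectors
`x_k - x_*, x_{k-1} - x_*, ∇f(y_k), w_{k+1}` (`sum_mul_inner_nonneg_of_posSemidef`), and adding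
the quadratic upper bound of `f` at `x_{k+1}`, the strong convexity bounds at `x_k` and `x_*`, and
the interpolation inequality between `y_k` and `x_*`, gives
`V_{k+1} ≤ p V_k + q V_{k-1} + r ‖w_{k+1}‖²` (`Params.Feasible.V_step_le`), with the convention
`V_{-1} = V_0`. Since `λ₊ (λ₊ - p) = q`, the sequence `T_k = V_k + (λ₊ - p) V_{k-1}` satisfies
`T_{k+1} ≤ λ₊ T_k + r ‖w_{k+1}‖²`, and summing it bounds `∑_{k ≤ K} V_k` by `V_0` and a weighted
sum of squared noise norms. There are two ways to pass from `∑ T_k` to `∑ V_k`: drop the terms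
`(λ₊ - p) V_{k-1}` (`Params.Feasible.sum_le_pathBound_div`), or sum up to `K + 1`, where every
`V_k` with `k ≤ K` occurs with total weight `1 + λ₊ - p = 1 / J`
(`Params.Feasible.sum_le_pathBound_succ`). They yield the two terms of the minimum. Finally
`lyapConst · (f(x_k) - f_*) ≤ V_k`, because `r̃(P̃)` is the Schur complement of `P̃`.

*Probabilistic part.* Integrating the conditional tail bound gives
`E[exp(s ‖w_{k+1}‖²) | ℱ_k] ≤ (1 + 2σ²s) / (1 - 2σ²s)` when `0 ≤ s` and `2σ²s < 1`; it is proved in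
the integrated form `lintegral_mul_exp_sq_le`, against an arbitrary nonnegative `ℱ_k`-measurable
weight. Conditioning successively bounds the joint moment by the product of these factors
(`SubGaussianNoise.lintegral_exp_sum_sq_le`), whose logarithm is the sum in `cHat`; the condition
`√θ H̄∞ < 1` is what keeps all exponents below the threshold.
-/

namespace GMM

/-! ### Smooth and strongly convex functions -/

section FirstOrder

open scoped RealInnerProductSpace

variable {E : Type*} [NormedAddCommGroup E] [InnerProductSpace ℝ E]

theorem hasDerivAt_comp_line [CompleteSpace E] {f : E → ℝ} (hf : Differentiable ℝ f) (x v : E)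
    (t : ℝ) :
    HasDerivAt (fun s : ℝ => f (x + s • v)) ⟪gradient f (x + t • v), v⟫ t := by
  have h1 : HasDerivAt (fun s : ℝ => x + s • v) v t := by
    simpa using ((hasDerivAt_id t).smul_const v).const_add x
  have h2 := (hf (x + t • v)).hasFDerivAt.comp_hasDerivAt t h1
  rw [inner_gradient_left]
  exact h2

/-- Quadratic upper bound for a function with Lipschitz gradient. -/
theorem le_add_inner_gradient_add_sq [CompleteSpace E] {f : E → ℝ} {L : ℝ}
    (hf : Differentiable ℝ f)
    (hL : ∀ x y, ‖gradient f x - gradient f y‖ ≤ L * ‖x - y‖) (x z : E) :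
    f z ≤ f x + ⟪gradient f x, z - x⟫ + L / 2 * ‖z - x‖ ^ 2 := by
  set v := z - x with hv
  let φ : ℝ → ℝ := fun t => f (x + t • v) - t * ⟪gradient f x, v⟫ - L / 2 * ‖v‖ ^ 2 * t ^ 2
  have hφ : ∀ t, HasDerivAt φ
      (⟪gradient f (x + t • v), v⟫ - ⟪gradient f x, v⟫ - L / 2 * ‖v‖ ^ 2 * (2 * t)) t := by
    intro t
    have h1 := (hasDerivAt_comp_line hf x v t).sub
      ((hasDerivAt_id t).mul_const ⟪gradient f x, v⟫)
    have h2 := h1.sub ((hasDerivAt_pow 2 t).const_mul (L / 2 * ‖v‖ ^ 2))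
    exact h2.congr_deriv (by simp)
  have hanti : AntitoneOn φ (Set.Icc 0 1) := by
    refine antitoneOn_of_hasDerivWithinAt_nonpos (convex_Icc 0 1)
      (fun t _ => (hφ t).continuousAt.continuousWithinAt)
      (fun t _ => (hφ t).hasDerivWithinAt) ?_
    intro t ht
    rw [interior_Icc] at ht
    have h1 : ⟪gradient f (x + t • v) - gradient f x, v⟫ ≤ L * ‖t • v‖ * ‖v‖ := by
      refine (real_inner_le_norm _ _).trans ?_
      gcongr
      simpa using hL (x + t • v) x
    rw [inner_sub_left, norm_smul, Real.norm_of_nonneg ht.1.le] at h1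
    nlinarith
  have h01 := hanti (Set.left_mem_Icc.2 zero_le_one) (Set.right_mem_Icc.2 zero_le_one) zero_le_one
  simp only [φ, one_smul, zero_smul, add_zero, hv, add_sub_cancel] at h01
  rw [← hv] at h01
  linarith

/-- Quadratic lower bound for a differentiable strongly convex function. -/
theorem add_inner_gradient_add_sq_le [CompleteSpace E] {f : E → ℝ} {μ : ℝ}
    (hf : Differentiable ℝ f) (hμ : StrongConvexOn Set.univ μ f) (x z : E) :
    f x + ⟪gradient f x, z - x⟫ + μ / 2 * ‖z - x‖ ^ 2 ≤ f z := by
  rw [strongConvexOn_iff_convex] at hμ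
  have hline : ConvexOn ℝ Set.univ
      (fun t : ℝ => f (x + t • (z - x)) - μ / 2 * ‖x + t • (z - x)‖ ^ 2) := by
    have hcomp : (fun t : ℝ => f (x + t • (z - x)) - μ / 2 * ‖x + t • (z - x)‖ ^ 2) =
        (fun x => f x - μ / 2 * ‖x‖ ^ 2) ∘ AffineMap.lineMap x z := by
      funext t
      simp [AffineMap.lineMap_apply, add_comm]
    rw [hcomp]
    exact hμ.comp_affineMap (AffineMap.lineMap x z)
  have hd : HasDerivAt (fun t : ℝ => f (x + t • (z - x)) - μ / 2 * ‖x + t • (z - x)‖ ^ 2)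
      (⟪gradient f x, z - x⟫ - μ / 2 * (2 * ⟪x, z - x⟫)) 0 := by
    have h1 : HasDerivAt (fun s : ℝ => x + s • (z - x)) (z - x) 0 := by
      simpa using ((hasDerivAt_id (0 : ℝ)).smul_const (z - x)).const_add x
    have h2 := (hasDerivAt_comp_line hf x (z - x) 0).sub (h1.norm_sq.const_mul (μ / 2))
    exact h2.congr_deriv (by simp)
  have h := hline.le_slope_of_hasDerivAt (Set.mem_univ 0) (Set.mem_univ 1) zero_lt_one hd
  have hz : ‖z‖ ^ 2 = ‖x‖ ^ 2 + 2 * ⟪x, z - x⟫ + ‖z - x‖ ^ 2 := by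
    rw [← norm_add_sq_real]; simp
  simp only [slope_def_field, one_smul, zero_smul, add_zero, add_sub_cancel, sub_zero,
    div_one] at h
  rw [hz] at h
  linarith

theorem gradient_eq_zero_of_forall_le [CompleteSpace E] {f : E → ℝ} {xs : E}
    (h : ∀ x, f xs ≤ f x) : gradient f xs = 0 := by
  have : IsLocalMin f xs := Filter.Eventually.of_forall h
  simp [gradient, this.fderiv_eq_zero]

/-- Interpolation inequality between a point and a critical point: it combines the quadratic lower
bound at one of the two points with the quadratic upper bound at the other, both ways, at the two
points that make the combination tight. -/
theorem interpolation_inequality {f : E → ℝ} {μ L : ℝ} (hμL : μ < L) {xs y g : E}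
    (hlo_s : ∀ z, f xs + μ / 2 * ‖z - xs‖ ^ 2 ≤ f z)
    (hup_s : ∀ z, f z ≤ f xs + L / 2 * ‖z - xs‖ ^ 2)
    (hlo_y : ∀ z, f y + ⟪g, z - y⟫ + μ / 2 * ‖z - y‖ ^ 2 ≤ f z)
    (hup_y : ∀ z, f z ≤ f y + ⟪g, z - y⟫ + L / 2 * ‖z - y‖ ^ 2) :
    μ * L * ‖y - xs‖ ^ 2 - (μ + L) * ⟪g, y - xs⟫ + ‖g‖ ^ 2 ≤ 0 := by
  have hM : 0 < L - μ := sub_pos.2 hμL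
  set e := y - xs with he
  obtain ⟨t, ht⟩ : ∃ t, t = 1 / (L - μ) := ⟨_, rfl⟩
  have htM : t * (L - μ) = 1 := by rw [ht]; field_simp
  -- `y - t h` and `x + t h`, with `h = g - μ e` and `t = 1 / (L - μ)`, minimize the gaps.
  have h1 := (hlo_s (y - t • (g - μ • e))).trans (hup_y _)
  have h2 := (hlo_y (xs + t • (g - μ • e))).trans (hup_s _)
  have e1 : y - t • (g - μ • e) - xs = e - t • (g - μ • e) := by rw [he]; abel
  have e2 : y - t • (g - μ • e) - y = -(t • (g - μ • e)) := by abel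
  have e3 : xs + t • (g - μ • e) - y = t • (g - μ • e) - e := by rw [he]; abel
  have e4 : xs + t • (g - μ • e) - xs = t • (g - μ • e) := by abel
  rw [e1, e2] at h1
  rw [e3, e4] at h2
  simp only [← real_inner_self_eq_norm_sq, inner_sub_left, inner_sub_right, inner_neg_left,
    inner_neg_right, inner_smul_left, inner_smul_right, real_inner_comm g e,
    conj_trivial] at h1 h2 ⊢
  generalize ⟪g, g⟫ = gg at *
  generalize ⟪g, e⟫ = ge at *
  generalize ⟪e, e⟫ = ee at *
  have h3 : t * (μ * L * ee - (μ + L) * ge + gg) ≤ 0 := by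
    have hs := add_le_add h1 h2
    have hA : (t * t) * (L - μ) = t := by rw [mul_assoc, htM, mul_one]
    have hB : t * L = 1 + t * μ := by linarith
    linear_combination hs + (gg - 2 * μ * ge + μ ^ 2 * ee) * hA + (μ * ee - ge) * hB
  have ht0 : 0 < t := by rw [ht]; positivity
  exact nonpos_of_mul_nonpos_right h3 ht0

end FirstOrder

/-! ### Exponential moments of conditionally sub-Gaussian noise -/

section SubGaussian

open scoped ENNReal

/-- A bound on a conditional probability, integrated against a nonnegative weight that is
measurable with respect to the conditioning σ-algebra. -/
theorem setLIntegral_le_mul_of_condExp_indicator_le {Ω : Type*} {m₀ m : MeasurableSpace Ω}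
    {Pr : Measure Ω} [IsFiniteMeasure Pr] (hm : m₀ ≤ m) {B : Set Ω} (hB : MeasurableSet B)
    {ε : ℝ} (hε : ∀ᵐ ω ∂Pr, (Pr⟦B | m₀⟧) ω ≤ ε) {G : Ω → ℝ≥0∞} (hG : Measurable[m₀] G) :
    ∫⁻ ω in B, G ω ∂Pr ≤ ENNReal.ofReal ε * ∫⁻ ω, G ω ∂Pr := by
  have hle : (Pr.restrict B).trim hm ≤ ENNReal.ofReal ε • Pr.trim hm := by
    refine Measure.le_iff.2 fun A hA => ?_
    rw [Measure.smul_apply, smul_eq_mul, trim_measurableSet_eq hm hA,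
      trim_measurableSet_eq hm hA, Measure.restrict_apply (hm A hA)]
    have hint : Integrable (B.indicator fun _ => (1 : ℝ)) Pr :=
      (integrable_const 1).indicator hB
    have h1 : ∫ ω in A, (Pr⟦B | m₀⟧) ω ∂Pr = Pr.real (A ∩ B) := by
      rw [setIntegral_condExp hm hint hA, setIntegral_indicator hB, setIntegral_const,
        smul_eq_mul, mul_one]
    have h2 : ∫ ω in A, (Pr⟦B | m₀⟧) ω ∂Pr ≤ ∫ _ω in A, ε ∂Pr :=
      integral_mono_ae integrable_condExp.integrableOn (integrable_const ε)
        (ae_restrict_of_ae hε)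
    rw [h1, setIntegral_const, smul_eq_mul, mul_comm] at h2
    rw [← ofReal_measureReal (s := A ∩ B), ← ofReal_measureReal (s := A),
      ← ENNReal.ofReal_mul' measureReal_nonneg]
    exact ENNReal.ofReal_le_ofReal h2
  calc ∫⁻ ω in B, G ω ∂Pr = ∫⁻ ω, G ω ∂(Pr.restrict B).trim hm := (lintegral_trim hm hG).symm
    _ ≤ ∫⁻ ω, G ω ∂(ENNReal.ofReal ε • Pr.trim hm) := lintegral_mono' hle le_rfl
    _ = ENNReal.ofReal ε * ∫⁻ ω, G ω ∂Pr := by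
      rw [lintegral_smul_measure, lintegral_trim hm hG, smul_eq_mul]

/-- The exponential moment of the square of a variable with conditional sub-Gaussian tails, by
integration of the tail bound (layer cake) under the weighted measure `G · Pr`. -/
theorem lintegral_mul_exp_sq_le {Ω : Type*} {m₀ m : MeasurableSpace Ω}
    {Pr : Measure Ω} [IsFiniteMeasure Pr] (hm : m₀ ≤ m) {E : Type*} [NormedAddCommGroup E]
    [MeasurableSpace E] [BorelSpace E] {W : Ω → E} (hW : Measurable W) {σ : ℝ} (hσ : 0 < σ)
    (htail : ∀ t : ℝ, 0 ≤ t →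
      ∀ᵐ ω ∂Pr, (Pr⟦{ω' | t ≤ ‖W ω'‖} | m₀⟧) ω ≤ 2 * Real.exp (-t ^ 2 / (2 * σ ^ 2)))
    {s : ℝ} (hs : 0 ≤ s) (hsσ : 2 * σ ^ 2 * s < 1) {G : Ω → ℝ≥0∞} (hG : Measurable[m₀] G) :
    ∫⁻ ω, G ω * ENNReal.ofReal (Real.exp (s * ‖W ω‖ ^ 2)) ∂Pr ≤
      ENNReal.ofReal ((1 + 2 * σ ^ 2 * s) / (1 - 2 * σ ^ 2 * s)) * ∫⁻ ω, G ω ∂Pr := by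
  have hGm : Measurable G := hG.mono hm le_rfl
  have hsq : Measurable fun ω => ‖W ω‖ ^ 2 := hW.norm.pow_const 2
  have hτ : 0 < 1 / (2 * σ ^ 2) - s := by
    rw [sub_pos, lt_div_iff₀ (by positivity)]; linarith
  have hlayer := lintegral_comp_eq_lintegral_meas_le_mul (Pr.withDensity G)
    (f := fun ω => ‖W ω‖ ^ 2) (g := fun t => s * Real.exp (s * t))
    (Filter.Eventually.of_forall fun ω => sq_nonneg _) hsq.aemeasurable
    (fun t _ => (by fun_prop : Continuous fun t => s * Real.exp (s * t)).intervalIntegrable _ _)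
    (Filter.Eventually.of_forall fun t => by positivity)
  have hprim : ∀ u : ℝ, ∫ t in (0 : ℝ)..u, s * Real.exp (s * t) = Real.exp (s * u) - 1 := by
    intro u
    have hd : ∀ t ∈ Set.uIcc 0 u,
        HasDerivAt (fun t => Real.exp (s * t)) (s * Real.exp (s * t)) t := by
      intro t _
      have := ((hasDerivAt_id t).const_mul s).exp
      simpa [mul_comm] using this
    rw [intervalIntegral.integral_eq_sub_of_hasDerivAt hd
      ((by fun_prop : Continuous fun t => s * Real.exp (s * t)).intervalIntegrable _ _)]
    simp
  simp only [hprim] at hlayer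
  have hsplit : ∫⁻ ω, G ω * ENNReal.ofReal (Real.exp (s * ‖W ω‖ ^ 2)) ∂Pr =
      ∫⁻ ω, G ω ∂Pr + ∫⁻ ω, ENNReal.ofReal (Real.exp (s * ‖W ω‖ ^ 2) - 1) ∂(Pr.withDensity G) := by
    rw [lintegral_withDensity_eq_lintegral_mul _ hGm (by fun_prop), ← lintegral_add_left hGm]
    refine lintegral_congr fun ω => ?_
    have h1 : (1 : ℝ) ≤ Real.exp (s * ‖W ω‖ ^ 2) := Real.one_le_exp (by positivity)
    have h2 : ENNReal.ofReal (Real.exp (s * ‖W ω‖ ^ 2)) =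
        1 + ENNReal.ofReal (Real.exp (s * ‖W ω‖ ^ 2) - 1) := by
      rw [← ENNReal.ofReal_one, ← ENNReal.ofReal_add zero_le_one (by linarith)]
      congr 1; ring
    rw [h2, mul_add, mul_one, Pi.mul_apply]
  have htail' : ∀ t ∈ Set.Ioi (0 : ℝ), (Pr.withDensity G) {ω | t ≤ ‖W ω‖ ^ 2} *
      ENNReal.ofReal (s * Real.exp (s * t)) ≤
      ENNReal.ofReal (2 * s * Real.exp (-(1 / (2 * σ ^ 2) - s) * t)) * ∫⁻ ω, G ω ∂Pr := by
    intro t ht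
    have ht0 : 0 ≤ t := le_of_lt ht
    have hset : {ω | t ≤ ‖W ω‖ ^ 2} = {ω | √t ≤ ‖W ω‖} := by
      ext ω
      exact (Real.sqrt_le_left (norm_nonneg _)).symm
    have hBm : MeasurableSet {ω | √t ≤ ‖W ω‖} := measurableSet_le measurable_const hW.norm
    have h := setLIntegral_le_mul_of_condExp_indicator_le hm hBm (htail _ (Real.sqrt_nonneg t)) hG
    rw [hset, withDensity_apply _ hBm]
    refine (mul_le_mul_left h _).trans_eq ?_
    rw [mul_right_comm, ← ENNReal.ofReal_mul (by positivity)]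
    congr 2
    rw [Real.sq_sqrt ht0, mul_mul_mul_comm, ← Real.exp_add]
    congr 2
    ring
  have hI : IntegrableOn (fun t => 2 * s * Real.exp (-(1 / (2 * σ ^ 2) - s) * t))
      (Set.Ioi (0 : ℝ)) := (integrableOn_exp_mul_Ioi (neg_neg_of_pos hτ) 0).const_mul _
  rw [hsplit, hlayer]
  calc _ ≤ ∫⁻ ω, G ω ∂Pr + ∫⁻ t in Set.Ioi (0 : ℝ),
        ENNReal.ofReal (2 * s * Real.exp (-(1 / (2 * σ ^ 2) - s) * t)) * ∫⁻ ω, G ω ∂Pr := by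
        gcongr 1
        exact setLIntegral_mono' measurableSet_Ioi htail'
    _ = _ := by
      rw [lintegral_mul_const _ (by fun_prop), ← ofReal_integral_eq_lintegral_ofReal hI
        (Filter.Eventually.of_forall fun t => by positivity), integral_const_mul,
        integral_exp_mul_Ioi (neg_neg_of_pos hτ)]
      nth_rewrite 1 [← one_mul (∫⁻ ω, G ω ∂Pr)]
      rw [← add_mul, ← ENNReal.ofReal_one, ← ENNReal.ofReal_add zero_le_one]
      · congr 2
        obtain ⟨u, hu⟩ : ∃ u, u = 1 - 2 * σ ^ 2 * s := ⟨_, rfl⟩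
        have h1 : u ≠ 0 := by rw [hu]; linarith
        have h2 : 1 / (2 * σ ^ 2) - s = u / (2 * σ ^ 2) := by rw [hu]; field_simp
        rw [mul_zero, Real.exp_zero, h2, ← hu, eq_div_iff h1]
        field_simp
        rw [hu]
        ring
      · rw [mul_zero, Real.exp_zero, div_neg, neg_div, neg_neg]
        positivity

/-- Successive conditioning bounds the joint exponential moment of the squared noise norms. -/
theorem SubGaussianNoise.lintegral_exp_sum_sq_le {Ω : Type*} {m : MeasurableSpace Ω}
    {Pr : Measure Ω} [IsProbabilityMeasure Pr] {d : ℕ} {ℱ : Filtration ℕ m} {σ : ℝ}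
    (hσ : 0 < σ) {w : ℕ → Ω → EuclideanSpace ℝ (Fin d)} (hw : SubGaussianNoise Pr ℱ σ w)
    (s : ℕ → ℝ) (n : ℕ) (hs : ∀ k < n, 0 ≤ s k) (hsσ : ∀ k < n, 2 * σ ^ 2 * s k < 1) :
    ∫⁻ ω, ENNReal.ofReal (Real.exp (∑ k ∈ Finset.range n, s k * ‖w (k + 1) ω‖ ^ 2)) ∂Pr ≤
      ENNReal.ofReal
        (∏ k ∈ Finset.range n, (1 + 2 * σ ^ 2 * s k) / (1 - 2 * σ ^ 2 * s k)) := by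
  induction n with
  | zero => simp
  | succ n ih =>
    have ih' := ih (fun k hk => hs k (by omega)) (fun k hk => hsσ k (by omega))
    have hmeas : Measurable[ℱ n] fun ω =>
        ENNReal.ofReal (Real.exp (∑ k ∈ Finset.range n, s k * ‖w (k + 1) ω‖ ^ 2)) := by
      refine ENNReal.measurable_ofReal.comp (Real.measurable_exp.comp ?_)
      refine Finset.measurable_sum _ fun k hk => ?_
      have hk : k + 1 ≤ n := by simpa using hk
      have hcont : Continuous fun v : EuclideanSpace ℝ (Fin d) => s k * ‖v‖ ^ 2 := by fun_prop
      exact hcont.measurable.comp ((hw.adapted k).mono (ℱ.mono hk) le_rfl)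
    have hstep := lintegral_mul_exp_sq_le (ℱ.le n)
      ((hw.adapted n).mono (ℱ.le _) le_rfl) hσ (hw.tail n) (hs n (by omega))
      (hsσ n (by omega)) hmeas
    calc _ = ∫⁻ ω, ENNReal.ofReal (Real.exp (∑ k ∈ Finset.range n, s k * ‖w (k + 1) ω‖ ^ 2)) *
          ENNReal.ofReal (Real.exp (s n * ‖w (n + 1) ω‖ ^ 2)) ∂Pr := by
          refine lintegral_congr fun ω => ?_
          rw [Finset.sum_range_succ, Real.exp_add, ENNReal.ofReal_mul (Real.exp_nonneg _)]
      _ ≤ _ := hstep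
      _ ≤ _ := by
        rw [Finset.prod_range_succ, mul_comm (∏ k ∈ _, _), ENNReal.ofReal_mul]
        · gcongr
        · have h0 := hs n (by omega)
          have h1 := hsσ n (by omega)
          exact div_nonneg (by positivity) (by linarith)

end SubGaussian

/-! ### One-step decrease of the Lyapunov function -/

section Lyapunov

open scoped RealInnerProductSpace

/-- A positive semidefinite matrix stays positive semidefinite after tensoring with the identity:
it is nonnegative on the Gram matrix of any family of vectors. -/
theorem sum_mul_inner_nonneg_of_posSemidef {ι : Type*} [Fintype ι] {d : ℕ} {M : Matrix ι ι ℝ}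
    (hM : M.PosSemidef) (z : ι → EuclideanSpace ℝ (Fin d)) :
    0 ≤ ∑ i, ∑ j, M i j * ⟪z i, z j⟫ := by
  have h : ∑ i, ∑ j, M i j * ⟪z i, z j⟫ =
      ∑ k, ∑ i, z i k * ∑ j, M i j * z j k := by
    rw [Finset.sum_comm (s := (Finset.univ : Finset (Fin d)))]
    refine Finset.sum_congr rfl fun i _ => ?_
    simp only [Finset.mul_sum]
    rw [Finset.sum_comm]
    refine Finset.sum_congr rfl fun j _ => ?_
    simp only [PiLp.inner_apply, RCLike.inner_apply, conj_trivial, Finset.mul_sum]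
    exact Finset.sum_congr rfl fun k _ => by ring
  rw [h]
  refine Finset.sum_nonneg fun k _ => ?_
  have := hM.dotProduct_mulVec_nonneg fun i => z i k
  simpa [dotProduct, Matrix.mulVec] using this

theorem stack_dotProduct_kronecker_one_mulVec {P : Matrix (Fin 2) (Fin 2) ℝ}
    (hP : P 1 0 = P 0 1) {d : ℕ} (u v : EuclideanSpace ℝ (Fin d)) :
    Params.stack u v ⬝ᵥ ((P ⊗ₖ (1 : Matrix (Fin d) (Fin d) ℝ)) *ᵥ Params.stack u v) =
      P 0 0 * ⟪u, u⟫ + 2 * P 0 1 * ⟪u, v⟫ + P 1 1 * ⟪v, v⟫ := by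
  simp only [PiLp.inner_apply, RCLike.inner_apply, conj_trivial, Finset.mul_sum,
    ← Finset.sum_add_distrib]
  simp only [dotProduct, Matrix.mulVec, Fintype.sum_prod_type, Fin.sum_univ_two, Params.stack,
    Matrix.kroneckerMap_apply, Matrix.one_apply, mul_ite, ite_mul, mul_one, mul_zero, zero_mul,
    Finset.sum_ite_eq, Finset.mem_univ, if_true, one_ne_zero, if_false, hP,
    ← Finset.sum_add_distrib]
  exact Finset.sum_congr rfl fun k _ => by ring

theorem StronglyConvexSmooth.subopt_lower {μ L : ℝ} {d : ℕ} {f : EuclideanSpace ℝ (Fin d) → ℝ}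
    (hf : StronglyConvexSmooth μ L f) {xstar : EuclideanSpace ℝ (Fin d)}
    (hxstar : ∀ x, f xstar ≤ f x) (x : EuclideanSpace ℝ (Fin d)) :
    μ / 2 * ⟪x - xstar, x - xstar⟫ ≤ f x - f xstar := by
  have h := add_inner_gradient_add_sq_le (hf.contDiff.differentiable one_ne_zero)
    hf.strongConvex xstar x
  rw [gradient_eq_zero_of_forall_le hxstar, inner_zero_left] at h
  rw [real_inner_self_eq_norm_sq]
  linarith

theorem StronglyConvexSmooth.subopt_upper {μ L : ℝ} {d : ℕ} {f : EuclideanSpace ℝ (Fin d) → ℝ}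
    (hf : StronglyConvexSmooth μ L f) {xstar : EuclideanSpace ℝ (Fin d)}
    (hxstar : ∀ x, f xstar ≤ f x) (x : EuclideanSpace ℝ (Fin d)) :
    f x - f xstar ≤ L / 2 * ⟪x - xstar, x - xstar⟫ := by
  have h := le_add_inner_gradient_add_sq (hf.contDiff.differentiable one_ne_zero)
    hf.lipschitz_gradient xstar x
  rw [gradient_eq_zero_of_forall_le hxstar, inner_zero_left] at h
  rw [real_inner_self_eq_norm_sq]
  linarith

namespace Params.Feasible

variable {c : Params} (hc : c.Feasible)
include hc

theorem P_symm : c.P 1 0 = c.P 0 1 := by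
  simpa using hc.P_posSemidef.isHermitian.apply 0 1

theorem P_zero_zero_nonneg : 0 ≤ c.P 0 0 := hc.P_posSemidef.diag_nonneg

theorem P_one_one_nonneg : 0 ≤ c.P 1 1 := hc.P_posSemidef.diag_nonneg

theorem P_zero_one_sq_le : c.P 0 1 ^ 2 ≤ c.P 0 0 * c.P 1 1 := by
  have h := hc.P_posSemidef.det_nonneg
  rw [Matrix.det_fin_two, hc.P_symm] at h
  linarith

theorem rTilde_nonneg : 0 ≤ c.rTilde := by
  unfold rTilde
  split_ifs with h
  · have h1 : 0 < c.P 1 1 := lt_of_le_of_ne hc.P_one_one_nonneg (Ne.symm h)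
    rw [sub_nonneg, div_le_iff₀ h1]
    exact hc.P_zero_one_sq_le
  · exact hc.P_zero_zero_nonneg

/-- `r̃(P̃)` is the Schur complement of the lower corner of `P̃`: it bounds the form from below by
its minimum over the second vector. -/
theorem rTilde_mul_inner_le {E : Type*} [NormedAddCommGroup E] [InnerProductSpace ℝ E] (u v : E) :
    c.rTilde * ⟪u, u⟫ ≤ c.P 0 0 * ⟪u, u⟫ + 2 * c.P 0 1 * ⟪u, v⟫ + c.P 1 1 * ⟪v, v⟫ := by
  unfold rTilde
  split_ifs with h
  · have h1 : 0 ≤ c.P 1 1 * ⟪v + (c.P 0 1 / c.P 1 1) • u, v + (c.P 0 1 / c.P 1 1) • u⟫ :=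
      mul_nonneg hc.P_one_one_nonneg real_inner_self_nonneg
    simp only [inner_add_left, inner_add_right, inner_smul_left, inner_smul_right, conj_trivial,
      real_inner_comm u v] at h1
    refine sub_nonneg.1 (h1.trans_eq ?_)
    field_simp
    ring
  · have h0 : c.P 1 1 = 0 := not_not.1 h
    have h1 := hc.P_zero_one_sq_le
    rw [h0, mul_zero] at h1
    have h2 : c.P 0 1 = 0 := pow_eq_zero_iff two_ne_zero |>.1 (le_antisymm h1 (sq_nonneg _))
    simp [h0, h2]

theorem r_nonneg : 0 ≤ c.r := by
  have h1 := hc.a_nonneg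
  have h2 := hc.c₁_nonneg
  have h3 := hc.P_zero_zero_nonneg
  have h4 := hc.μ_pos.trans hc.μ_lt_L
  unfold r
  positivity

section Step

variable {d : ℕ} {f : EuclideanSpace ℝ (Fin d) → ℝ} (hf : StronglyConvexSmooth c.μ c.L f)
  {xstar : EuclideanSpace ℝ (Fin d)} (hxstar : ∀ x, f xstar ≤ f x)
include hf hxstar

/-- The Lyapunov function dominates the suboptimality of the current iterate. -/
theorem lyapConst_mul_subopt_le_V (x y : EuclideanSpace ℝ (Fin d)) :
    c.lyapConst * (f x - f xstar) ≤ c.V f xstar (x, y) := by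
  have hL := hc.μ_pos.trans hc.μ_lt_L
  have h1 := hc.rTilde_mul_inner_le (x - xstar) (y - xstar)
  have h2 := mul_le_mul_of_nonneg_left (hf.subopt_upper hxstar x)
    (mul_nonneg (div_nonneg zero_le_two hL.le) hc.rTilde_nonneg)
  have h3 : 2 / c.L * c.rTilde * (c.L / 2 * ⟪x - xstar, x - xstar⟫) =
      c.rTilde * ⟪x - xstar, x - xstar⟫ := by field_simp
  rw [h3] at h2
  unfold Params.V
  rw [stack_dotProduct_kronecker_one_mulVec hc.P_symm]
  unfold lyapConst
  linarith

theorem c₁_mul_subopt_le_V (x y : EuclideanSpace ℝ (Fin d)) :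
    c.c₁ * (f x - f xstar) ≤ c.V f xstar (x, y) := by
  refine le_trans ?_ (hc.lyapConst_mul_subopt_le_V hf hxstar x y)
  refine mul_le_mul_of_nonneg_right ?_ (sub_nonneg.2 (hxstar x))
  have := div_nonneg zero_le_two (hc.μ_pos.trans hc.μ_lt_L).le
  have := mul_nonneg this hc.rTilde_nonneg
  unfold lyapConst
  linarith

theorem V_nonneg (x y : EuclideanSpace ℝ (Fin d)) : 0 ≤ c.V f xstar (x, y) :=
  (mul_nonneg hc.c₁_nonneg (sub_nonneg.2 (hxstar x))).trans
    (hc.c₁_mul_subopt_le_V hf hxstar x y)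

/-- The part of the one-step decrease that the matrix inequality certifies, before the gradient
and the distances to the minimizer are bounded by values of the Lyapunov function. -/
theorem V_step_le_of_matrix_ineq (x y w : EuclideanSpace ℝ (Fin d)) :
    c.V f xstar (x - c.α • (gradient f (x + c.ν • (x - y)) + w) + c.β • (x - y), x) ≤
      c.ρ₀ ^ 2 * c.V f xstar (x, y) +
      c.b * c.c₁ ^ 2 * ⟪gradient f (x + c.ν • (x - y)), gradient f (x + c.ν • (x - y))⟫ +
      c.r * ⟪w, w⟫ +
      c.c₁ * c.ρ₁ ^ 2 * (c.V f xstar (x, y) - c.c₁ * (f x - f xstar)) +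
      c.c₁ * (c.μ / 2 * (c.ρ₂ ^ 2 * ⟪x - xstar, x - xstar⟫ +
        c.ρ₃ ^ 2 * ⟪y - xstar, y - xstar⟫)) := by
  have hd := hf.contDiff.differentiable one_ne_zero
  obtain ⟨u, hu⟩ : ∃ u, u = x - xstar := ⟨_, rfl⟩
  obtain ⟨v, hv⟩ : ∃ v, v = y - xstar := ⟨_, rfl⟩
  obtain ⟨z, hz⟩ : ∃ z, z = x + c.ν • (x - y) := ⟨_, rfl⟩
  rw [← hz]
  obtain ⟨g, hg⟩ : ∃ g, g = gradient f z := ⟨_, rfl⟩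
  rw [← hg]
  obtain ⟨x', hx'⟩ : ∃ x', x' = x - c.α • (g + w) + c.β • (x - y) := ⟨_, rfl⟩
  rw [← hx']
  have e1 : x' - z = (c.β - c.ν) • (u - v) - c.α • g - c.α • w := by
    rw [hx', hz, hu, hv]; module
  have e2 : x - z = -(c.ν • (u - v)) := by rw [hz, hu, hv]; module
  have e3 : xstar - z = c.ν • v - (1 + c.ν) • u := by rw [hz, hu, hv]; module
  have e4 : z - xstar = (1 + c.ν) • u - c.ν • v := by rw [hz, hu, hv]; module
  have e5 : x' - xstar = (1 + c.β) • u - c.β • v - c.α • g - c.α • w := by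
    rw [hx', hu, hv]; module
  have h1 := le_add_inner_gradient_add_sq hd hf.lipschitz_gradient z x'
  have h2 := add_inner_gradient_add_sq_le hd hf.strongConvex z x
  have h3 := add_inner_gradient_add_sq_le hd hf.strongConvex z xstar
  have h4 := interpolation_inequality hc.μ_lt_L (f := f) (xs := xstar) (y := z) (g := g)
    (fun t => by
      have := hf.subopt_lower hxstar t
      rw [real_inner_self_eq_norm_sq] at this; linarith)
    (fun t => by
      have := hf.subopt_upper hxstar t
      rw [real_inner_self_eq_norm_sq] at this; linarith)
    (fun t => by rw [hg]; exact add_inner_gradient_add_sq_le hd hf.strongConvex z t)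
    (fun t => by rw [hg]; exact le_add_inner_gradient_add_sq hd hf.lipschitz_gradient z t)
  have h5 := sum_mul_inner_nonneg_of_posSemidef hc.matrix_ineq ![u, v, g, w]
  simp only [← hg, e1, e2, e3, e4] at h1 h2 h3 h4
  unfold Params.V
  rw [stack_dotProduct_kronecker_one_mulVec hc.P_symm,
    stack_dotProduct_kronecker_one_mulVec hc.P_symm, e5, ← hu, ← hv]
  simp only [Fin.sum_univ_four, M₀, M₁, M₂, X, X₁, X₂, X₃, Z, Amat, Bmat, Cmat, Δ,
    Matrix.add_apply, Matrix.smul_apply, Matrix.mul_apply, Fin.sum_univ_two, smul_eq_mul,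
    Matrix.transpose_apply, Matrix.of_apply, Matrix.cons_val,
    Finset.univ_unique, Finset.sum_singleton, Fin.default_eq_zero, Fin.isValue, hc.P_symm] at h5
  simp only [← real_inner_self_eq_norm_sq, inner_sub_left, inner_sub_right, inner_neg_left,
    inner_neg_right, inner_smul_left, inner_smul_right, conj_trivial, real_inner_comm u v,
    real_inner_comm u g, real_inner_comm u w, real_inner_comm v g, real_inner_comm v w,
    real_inner_comm g w] at h1 h2 h3 h4 h5 ⊢
  generalize ⟪u, u⟫ = uu at *
  generalize ⟪v, v⟫ = vv at *
  generalize ⟪g, g⟫ = gg at *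
  generalize ⟪w, w⟫ = ww at *
  have hρ : c.ρ₀ ^ 2 ≤ 1 := pow_le_one₀ hc.ρ₀_mem.1 hc.ρ₀_mem.2.le
  have k1 := mul_le_mul_of_nonneg_left h1 hc.c₁_nonneg
  have k2 := mul_le_mul_of_nonneg_left h2 (mul_nonneg hc.c₁_nonneg (sq_nonneg c.ρ₀))
  have k3 := mul_le_mul_of_nonneg_left h3 (mul_nonneg hc.c₁_nonneg (sub_nonneg.2 hρ))
  have k4 := mul_le_mul_of_nonneg_left h4 (mul_nonneg zero_le_two hc.c₀_nonneg)
  unfold r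
  linear_combination k1 + k2 + k3 + k4 + h5

/-- One step of the method: `V_{k+1} ≤ p V_k + q V_{k-1} + r ‖w_{k+1}‖²`. Of the value `V_{k-1}`
only the bound `c₁ (f(x_{k-1}) - f_*) ≤ V_{k-1}` matters. -/
theorem V_step_le (x y w : EuclideanSpace ℝ (Fin d)) {Vprev : ℝ}
    (hVprev : c.c₁ * (f y - f xstar) ≤ Vprev) :
    c.V f xstar (x - c.α • (gradient f (x + c.ν • (x - y)) + w) + c.β • (x - y), x) ≤
      c.p * c.V f xstar (x, y) + c.q * Vprev + c.r * ‖w‖ ^ 2 := by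
  have hμ := hc.μ_pos
  have hL := hc.μ_pos.trans hc.μ_lt_L
  have h := hc.V_step_le_of_matrix_ineq hf hxstar x y w
  have hV := hc.c₁_mul_subopt_le_V hf hxstar x y
  have hx := hf.subopt_lower hxstar x
  have hy := hf.subopt_lower hxstar y
  have hb := hc.b_nonneg
  have hc₁ := hc.c₁_nonneg
  have hφ := sub_nonneg.2 (hxstar x)
  obtain ⟨z, hz⟩ : ∃ z, z = x + c.ν • (x - y) := ⟨_, rfl⟩
  rw [← hz] at h ⊢
  have hg : ⟪gradient f z, gradient f z⟫ ≤ c.L ^ 2 *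
      (2 * (1 + c.ν) ^ 2 * ⟪x - xstar, x - xstar⟫ + 2 * c.ν ^ 2 * ⟪y - xstar, y - xstar⟫) := by
    have h1 := hf.lipschitz_gradient z xstar
    rw [gradient_eq_zero_of_forall_le hxstar, sub_zero] at h1
    have h2 := pow_le_pow_left₀ (norm_nonneg _) h1 2
    rw [mul_pow, ← real_inner_self_eq_norm_sq, ← real_inner_self_eq_norm_sq] at h2
    refine h2.trans (mul_le_mul_of_nonneg_left ?_ (sq_nonneg _))
    have e : z - xstar = (1 + c.ν) • (x - xstar) - c.ν • (y - xstar) := by rw [hz]; module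
    have h3 : 0 ≤ ⟪(1 + c.ν) • (x - xstar) + c.ν • (y - xstar),
      (1 + c.ν) • (x - xstar) + c.ν • (y - xstar)⟫ := real_inner_self_nonneg
    rw [e]
    generalize x - xstar = u at *
    generalize y - xstar = v at *
    simp only [inner_add_left, inner_add_right, inner_sub_left, inner_sub_right, inner_smul_left,
      inner_smul_right, conj_trivial, real_inner_comm u v] at h3 ⊢
    linear_combination h3
  rw [real_inner_self_eq_norm_sq w] at h
  generalize ⟪x - xstar, x - xstar⟫ = uu at *
  generalize ⟪y - xstar, y - xstar⟫ = vv at *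
  generalize ⟪gradient f z, gradient f z⟫ = gg at *
  generalize c.V f xstar (x, y) = V at *
  have hux : uu ≤ 2 / c.μ * (f x - f xstar) := by
    rw [div_mul_eq_mul_div, le_div_iff₀ hμ]; linarith
  have hvy : vv ≤ 2 / c.μ * (f y - f xstar) := by
    rw [div_mul_eq_mul_div, le_div_iff₀ hμ]; linarith
  have k0 : c.b * c.c₁ ^ 2 * gg ≤ c.b * c.c₁ ^ 2 * (c.L ^ 2 * (2 * (1 + c.ν) ^ 2 *
      (2 / c.μ * (f x - f xstar)) + 2 * c.ν ^ 2 * (2 / c.μ * (f y - f xstar)))) := by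
    gcongr
    refine hg.trans ?_
    gcongr
  have k1 := mul_le_mul_of_nonneg_left hV
    (by positivity : 0 ≤ c.ρ₂ ^ 2 + 4 * c.b * (1 + c.ν) ^ 2 * c.L ^ 2 / c.μ * c.c₁)
  have k2 := mul_le_mul_of_nonneg_left hVprev
    (by positivity : 0 ≤ c.ρ₃ ^ 2 + 4 * c.b * c.ν ^ 2 * c.L ^ 2 / c.μ * c.c₁)
  have k3 := mul_le_mul_of_nonneg_left hx (by positivity : 0 ≤ c.c₁ * c.ρ₂ ^ 2)
  have k4 := mul_le_mul_of_nonneg_left hy (by positivity : 0 ≤ c.c₁ * c.ρ₃ ^ 2)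
  have k5 : 0 ≤ c.c₁ * c.ρ₁ ^ 2 * (c.c₁ * (f x - f xstar)) := by positivity
  unfold p q
  linear_combination h + k0 + k1 + k2 + k3 + k4 + k5

end Step

end Params.Feasible

end Lyapunov

/-! ### The two-term recursion for the Lyapunov function -/

section Recursion

/-- Unrolled first-order recursion, summed over time. -/
theorem sum_range_le_of_le_mul_add {T x : ℕ → ℝ} {lam : ℝ} (h0 : 0 ≤ lam) (h1 : lam < 1)
    (hT : ∀ k, T (k + 1) ≤ lam * T k + x k) (N : ℕ) :
    ∑ k ∈ Finset.range (N + 1), T k ≤ (1 - lam ^ (N + 1)) / (1 - lam) * T 0 +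
      ∑ k ∈ Finset.range N, (1 - lam ^ (N - k)) / (1 - lam) * x k := by
  have hne : 1 - lam ≠ 0 := (sub_pos.2 h1).ne'
  induction N with
  | zero => simp [hne]
  | succ N ih =>
    have hsum : ∑ k ∈ Finset.range (N + 1), T (k + 1) ≤
        lam * ∑ k ∈ Finset.range (N + 1), T k + ∑ k ∈ Finset.range (N + 1), x k := by
      rw [Finset.mul_sum, ← Finset.sum_add_distrib]
      exact Finset.sum_le_sum fun k _ => hT k
    have hlast : ∑ k ∈ Finset.range (N + 1), (1 - lam ^ (N + 1 - k)) / (1 - lam) * x k =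
        lam * ∑ k ∈ Finset.range N, (1 - lam ^ (N - k)) / (1 - lam) * x k +
          ∑ k ∈ Finset.range (N + 1), x k := by
      rw [Finset.sum_range_succ, Finset.sum_range_succ x, Finset.mul_sum, ← add_assoc,
        ← Finset.sum_add_distrib]
      congr 1
      · refine Finset.sum_congr rfl fun k hk => ?_
        have hk : N + 1 - k = (N - k) + 1 := by
          have := Finset.mem_range.1 hk
          omega
        rw [hk]
        field_simp
        ring
      · rw [Nat.add_sub_cancel_left]
        field_simp
    have hmul := mul_le_mul_of_nonneg_left ih h0
    have hcoef : (1 - lam ^ (N + 1 + 1)) / (1 - lam) =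
        lam * ((1 - lam ^ (N + 1)) / (1 - lam)) + 1 := by
      field_simp
      ring
    rw [Finset.sum_range_succ', hlast, hcoef]
    linarith

namespace Params.Feasible

variable {c : Params} (hc : c.Feasible)
include hc

theorem p_nonneg : 0 ≤ c.p := by
  have h1 := hc.b_nonneg
  have h2 := hc.c₁_nonneg
  have h3 := hc.μ_pos
  unfold p
  positivity

theorem q_nonneg : 0 ≤ c.q := by
  have h1 := hc.b_nonneg
  have h2 := hc.c₁_nonneg
  have h3 := hc.μ_pos
  unfold q
  positivity

theorem lamPlus_mul_sub_p : c.lamPlus * (c.lamPlus - c.p) = c.q := by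
  have h := Real.sq_sqrt (by nlinarith [hc.q_nonneg, sq_nonneg c.p] : 0 ≤ c.p ^ 2 + 4 * c.q)
  unfold lamPlus
  linear_combination h / 4

theorem p_le_lamPlus : c.p ≤ c.lamPlus := by
  have h : c.p ≤ Real.sqrt (c.p ^ 2 + 4 * c.q) :=
    Real.le_sqrt_of_sq_le (by linarith [hc.q_nonneg])
  unfold lamPlus
  linarith

theorem lamPlus_nonneg : 0 ≤ c.lamPlus := hc.p_nonneg.trans hc.p_le_lamPlus

theorem lamPlus_lt_one : c.lamPlus < 1 := by
  have hp := hc.p_nonneg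
  have hq := hc.q_nonneg
  have hpq := hc.p_add_q_lt_one
  have h : Real.sqrt (c.p ^ 2 + 4 * c.q) < 2 - c.p := by
    rw [Real.sqrt_lt' (by linarith)]
    nlinarith
  unfold lamPlus
  linarith

theorem J_pos : 0 < c.J := by
  have := hc.p_le_lamPlus
  exact one_div_pos.2 (by linarith)

theorem J_le_one : c.J ≤ 1 := by
  have := hc.p_le_lamPlus
  exact (div_le_one (by linarith)).2 (by linarith)

theorem one_sub_p_add_q_eq : 1 - (c.p + c.q) = (1 - c.lamPlus) / c.J := by
  rw [J, div_div_eq_mul_div, div_one]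
  linear_combination hc.lamPlus_mul_sub_p

theorem aCoef_nonneg (j K : ℕ) : 0 ≤ c.aCoef j K := by
  have h1 := hc.p_add_q_lt_one
  have h2 : c.lamPlus ^ (K - j + 1) ≤ 1 := pow_le_one₀ hc.lamPlus_nonneg hc.lamPlus_lt_one.le
  exact div_nonneg (by linarith) (by linarith)

theorem aCoef_le (j K : ℕ) : c.aCoef j K ≤ 1 / (1 - (c.p + c.q)) := by
  have h1 := hc.p_add_q_lt_one
  have h2 : 0 ≤ c.lamPlus ^ (K - j + 1) := pow_nonneg hc.lamPlus_nonneg _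
  exact div_le_div_of_nonneg_right (by linarith) (by linarith)

end Params.Feasible

/-- The pathwise bound on the accumulated Lyapunov function over the horizon `N`: initial value
plus weighted squared noise norms, where `n k` stands for `‖w_{k+1}‖²`. -/
noncomputable def Params.pathBound (c : Params) (V₀ : ℝ) (n : ℕ → ℝ) (N : ℕ) : ℝ :=
  ((1 - c.lamPlus ^ (N + 1)) / (1 - c.lamPlus) - 1 + c.J) * V₀ +
    c.r * ∑ k ∈ Finset.range N, c.aCoef (k + 1) N * n k

namespace Params.Feasible

variable {c : Params} (hc : c.Feasible)
include hc

/-- The combination `T_k = V_k + (λ₊ - p) V_{k-1}` turns the second-order recursion into a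
first-order one with rate `λ₊`. The truncated subtraction encodes `V_{-1} = V_0`. -/
theorem sum_combined_le {V n : ℕ → ℝ}
    (hV : ∀ k, V (k + 1) ≤ c.p * V k + c.q * V (k - 1) + c.r * n k) (N : ℕ) :
    ∑ k ∈ Finset.range (N + 1), (V k + (c.lamPlus - c.p) * V (k - 1)) ≤
      1 / c.J * c.pathBound (V 0) n N + (c.lamPlus - c.p) * V 0 := by
  have hJ := hc.J_pos
  have hlam := hc.lamPlus_lt_one
  have h := sum_range_le_of_le_mul_add (T := fun k => V k + (c.lamPlus - c.p) * V (k - 1))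
    (x := fun k => c.r * n k) hc.lamPlus_nonneg hc.lamPlus_lt_one (fun k => by
      have := hV k
      rw [← hc.lamPlus_mul_sub_p] at this
      simp only [Nat.add_sub_cancel]
      linarith) N
  refine h.trans_eq ?_
  have hs : c.lamPlus - c.p = 1 / c.J - 1 := by rw [J, one_div_one_div]; ring
  have hsum : ∑ k ∈ Finset.range N, (1 - c.lamPlus ^ (N - k)) / (1 - c.lamPlus) * (c.r * n k) =
      1 / c.J * (c.r * ∑ k ∈ Finset.range N, c.aCoef (k + 1) N * n k) := by
    simp only [Finset.mul_sum]
    refine Finset.sum_congr rfl fun k hk => ?_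
    have hk : N - (k + 1) + 1 = N - k := by
      have := Finset.mem_range.1 hk
      omega
    have hne : 1 - c.lamPlus ≠ 0 := by linarith
    rw [aCoef, hk, hc.one_sub_p_add_q_eq]
    field_simp
  rw [hsum, hs, pathBound]
  simp only [Nat.zero_sub]
  field_simp
  ring

/-- Dropping the previous values in the combined sequence. -/
theorem sum_le_pathBound_div {V n : ℕ → ℝ} (hV₀ : ∀ k, 0 ≤ V k)
    (hV : ∀ k, V (k + 1) ≤ c.p * V k + c.q * V (k - 1) + c.r * n k) (N : ℕ) :
    ∑ k ∈ Finset.range (N + 1), V k ≤ 1 / c.J * c.pathBound (V 0) n N := by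
  have h := hc.sum_combined_le hV N
  have hs := sub_nonneg.2 hc.p_le_lamPlus
  rw [Finset.sum_add_distrib, ← Finset.mul_sum, Finset.sum_range_succ' (fun k => V (k - 1))] at h
  have h1 := mul_nonneg hs (Finset.sum_nonneg fun k (_ : k ∈ Finset.range N) => hV₀ k)
  simp only [Nat.add_sub_cancel, Nat.zero_sub] at h
  linarith

/-- Looking one step further: every value up to time `N` occurs in the combined sequence up to
time `N + 1` with total weight `1 + (λ₊ - p) = 1 / J`. -/
theorem sum_le_pathBound_succ {V n : ℕ → ℝ} (hV₀ : ∀ k, 0 ≤ V k)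
    (hV : ∀ k, V (k + 1) ≤ c.p * V k + c.q * V (k - 1) + c.r * n k) (N : ℕ) :
    ∑ k ∈ Finset.range (N + 1), V k ≤ c.pathBound (V 0) n (N + 1) := by
  have h := hc.sum_combined_le hV (N + 1)
  have hJ := hc.J_pos
  rw [Finset.sum_add_distrib, ← Finset.mul_sum, Finset.sum_range_succ' (fun k => V (k - 1)),
    Finset.sum_range_succ V (N + 1)] at h
  simp only [Nat.add_sub_cancel, Nat.zero_sub] at h
  have hs : c.lamPlus - c.p = 1 / c.J - 1 := by rw [J, one_div_one_div]; ring
  rw [hs] at h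
  have h1 : 1 / c.J * ∑ k ∈ Finset.range (N + 1), V k ≤ 1 / c.J * c.pathBound (V 0) n (N + 1) := by
    linarith [hV₀ (N + 1)]
  exact le_of_mul_le_mul_left h1 (one_div_pos.2 hJ)

end Params.Feasible

/-- The Lyapunov recursion along the iterates; at `k = 0` the truncated index `k - 1 = 0` stands
for the convention `V_{-1} = V_0`, which is legitimate because `x_{-1} = x_0`. -/
theorem V_state_succ_le {c : Params} (hc : c.Feasible) {d : ℕ}
    {f : EuclideanSpace ℝ (Fin d) → ℝ} (hf : StronglyConvexSmooth c.μ c.L f)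
    {xstar : EuclideanSpace ℝ (Fin d)} (hxstar : ∀ x, f xstar ≤ f x)
    (x₀ : EuclideanSpace ℝ (Fin d)) (w : ℕ → EuclideanSpace ℝ (Fin d)) (k : ℕ) :
    c.V f xstar (state c.α c.β c.ν f x₀ w (k + 1)) ≤
      c.p * c.V f xstar (state c.α c.β c.ν f x₀ w k) +
      c.q * c.V f xstar (state c.α c.β c.ν f x₀ w (k - 1)) + c.r * ‖w (k + 1)‖ ^ 2 := by
  refine hc.V_step_le hf hxstar (state c.α c.β c.ν f x₀ w k).1 (state c.α c.β c.ν f x₀ w k).2 _ ?_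
  cases k with
  | zero => exact hc.c₁_mul_subopt_le_V hf hxstar x₀ x₀
  | succ k => exact hc.c₁_mul_subopt_le_V hf hxstar _ _

end Recursion

/-! ### Risk-sensitive cost -/

section RiskBound

namespace Params.Feasible

variable {c : Params} (hc : c.Feasible)
include hc

/-- The condition `√η H̄∞ < 1` keeps every exponent below the sub-Gaussian threshold. -/
theorem r_mul_aCoef_lt {η : ℝ} (hη : 0 < η) (hH : Real.sqrt η * c.HBar < 1) (j K : ℕ) :
    c.r * η * c.aCoef j K < c.lyapConst := by
  have hpq := sub_pos.2 hc.p_add_q_lt_one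
  have hl := hc.lyapConst_pos
  have hr := hc.r_nonneg
  rw [HBar, ← Real.sqrt_mul hη.le, Real.sqrt_lt' one_pos, one_pow] at hH
  have h1 : η * (1 / (1 - (c.p + c.q)) * (c.r / c.lyapConst)) =
      c.r * η * (1 / (1 - (c.p + c.q))) / c.lyapConst := by ring
  rw [h1, div_lt_one hl] at hH
  exact (mul_le_mul_of_nonneg_left (hc.aCoef_le j K) (by positivity)).trans_lt hH

/-- A pathwise bound of the cumulative cost by a multiple of `pathBound` bounds the risk-sensitive
cost by the same multiple of `cBar`. -/
theorem riskCost_le_of_le_pathBound {d : ℕ} {Ω : Type*} [m : MeasurableSpace Ω] {Pr : Measure Ω}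
    [IsProbabilityMeasure Pr] {ℱ : Filtration ℕ m} {σ : ℝ} (hσ : 0 < σ)
    {w : ℕ → Ω → EuclideanSpace ℝ (Fin d)} (hw : SubGaussianNoise Pr ℱ σ w) {S : Ω → ℝ}
    {V₀ t θ : ℝ} (ht : 0 < t) (hθ : 0 < θ) (K N : ℕ)
    (hS : ∀ ω, c.lyapConst * S ω ≤ t * c.pathBound V₀ (fun k => ‖w (k + 1) ω‖ ^ 2) N) :
    riskCost Pr σ S K θ ≤ ((1 / (c.lyapConst * ((K : ℝ) + 1)) : ℝ) : EReal) *
      ((t : ℝ) * c.cBar σ V₀ N (t * θ)) := by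
  have hl := hc.lyapConst_pos
  have hr := hc.r_nonneg
  have hη : 0 < t * θ := mul_pos ht hθ
  have hK : 0 < (K : ℝ) + 1 := by positivity
  unfold cBar cHat
  split_ifs with hH
  swap
  · -- The condition fails: `cBar` is `⊤`, and positive factors keep it `⊤`.
    rw [EReal.coe_add_top, EReal.coe_mul_top_of_pos ht, EReal.coe_mul_top_of_pos (by positivity)]
    exact le_top
  have hlt := hc.r_mul_aCoef_lt hη hH
  set C := ((1 - c.lamPlus ^ (N + 1)) / (1 - c.lamPlus) - 1 + c.J) * V₀ with hC
  -- `s k` is the weight of `‖w_{k+1}‖²` in the exponent.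
  set s : ℕ → ℝ := fun k => t * θ / (2 * σ ^ 2 * c.lyapConst) * c.r * c.aCoef (k + 1) N with hs
  have hs0 : ∀ k, 0 ≤ s k := fun k => by
    have := hc.aCoef_nonneg (k + 1) N
    positivity
  have hs2 : ∀ k, 2 * σ ^ 2 * s k = c.r * (t * θ) * c.aCoef (k + 1) N / c.lyapConst := fun k => by
    simp only [hs]
    field_simp
  have hs1 : ∀ k, 2 * σ ^ 2 * s k < 1 := fun k => by
    rw [hs2, div_lt_one hl]
    exact hlt _ _
  have hfac : ∀ k, (1 + 2 * σ ^ 2 * s k) / (1 - 2 * σ ^ 2 * s k) =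
      (c.lyapConst + c.r * (t * θ) * c.aCoef (k + 1) N) /
        (c.lyapConst - c.r * (t * θ) * c.aCoef (k + 1) N) := fun k => by
    have h1 : c.lyapConst - c.r * (t * θ) * c.aCoef (k + 1) N ≠ 0 := (sub_pos.2 (hlt _ _)).ne'
    rw [hs2, one_add_div hl.ne', one_sub_div hl.ne', div_div_div_cancel_right₀ hl.ne']
  have hpos : ∀ k, 0 < (c.lyapConst + c.r * (t * θ) * c.aCoef (k + 1) N) /
        (c.lyapConst - c.r * (t * θ) * c.aCoef (k + 1) N) := fun k => by
    have := hc.aCoef_nonneg (k + 1) N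
    exact div_pos (by positivity) (sub_pos.2 (hlt _ _))
  set R := ∑ j ∈ Finset.Icc 1 N, Real.log ((c.lyapConst + c.r * (t * θ) * c.aCoef j N) /
    (c.lyapConst - c.r * (t * θ) * c.aCoef j N)) with hR
  have hR' : Real.exp R = ∏ k ∈ Finset.range N, (1 + 2 * σ ^ 2 * s k) / (1 - 2 * σ ^ 2 * s k) := by
    have hIcc : Finset.Icc 1 N = (Finset.range N).map (addRightEmbedding 1) := by
      rw [Finset.range_eq_Ico, Finset.map_add_right_Ico]
      rfl
    rw [hR, hIcc, Finset.sum_map, Real.exp_sum]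
    refine Finset.prod_congr rfl fun k _ => ?_
    rw [hfac, addRightEmbedding_apply, Real.exp_log (hpos k)]
  have hint : ∫⁻ ω, ENNReal.ofReal (Real.exp (θ / (2 * σ ^ 2) * S ω)) ∂Pr ≤
      ENNReal.ofReal (Real.exp (t * θ / (2 * σ ^ 2 * c.lyapConst) * C + R)) := by
    calc _ ≤ ∫⁻ ω, ENNReal.ofReal (Real.exp (t * θ / (2 * σ ^ 2 * c.lyapConst) * C)) *
          ENNReal.ofReal (Real.exp (∑ k ∈ Finset.range N, s k * ‖w (k + 1) ω‖ ^ 2)) ∂Pr := by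
          refine lintegral_mono fun ω => ?_
          rw [← ENNReal.ofReal_mul (Real.exp_nonneg _), ← Real.exp_add]
          refine ENNReal.ofReal_le_ofReal (Real.exp_le_exp.2 ?_)
          have h := mul_le_mul_of_nonneg_left (hS ω)
            (by positivity : 0 ≤ θ / (2 * σ ^ 2 * c.lyapConst))
          have h1 : θ / (2 * σ ^ 2 * c.lyapConst) * (c.lyapConst * S ω) =
              θ / (2 * σ ^ 2) * S ω := by field_simp
          rw [h1] at h
          refine h.trans_eq ?_
          simp only [pathBound, ← hC, hs, mul_assoc, ← Finset.mul_sum]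
          ring
      _ = ENNReal.ofReal (Real.exp (t * θ / (2 * σ ^ 2 * c.lyapConst) * C)) *
          ∫⁻ ω, ENNReal.ofReal
            (Real.exp (∑ k ∈ Finset.range N, s k * ‖w (k + 1) ω‖ ^ 2)) ∂Pr :=
          lintegral_const_mul' _ _ ENNReal.ofReal_ne_top
      _ ≤ _ := by
          rw [Real.exp_add, ENNReal.ofReal_mul (Real.exp_nonneg _), hR']
          gcongr
          exact hw.lintegral_exp_sum_sq_le hσ s N (fun k _ => hs0 k) (fun k _ => hs1 k)
  have hlog := ENNReal.log_monotone hint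
  rw [ENNReal.log_ofReal_of_pos (Real.exp_pos _), Real.log_exp] at hlog
  have hcoef : (0 : ℝ) ≤ 2 * σ ^ 2 / (((K : ℝ) + 1) * θ) := by positivity
  refine (mul_le_mul_of_nonneg_left hlog (EReal.coe_nonneg.2 hcoef)).trans_eq ?_
  norm_cast
  field_simp

end Params.Feasible

end RiskBound

end GMM

theorem mainTheorem3 {d : ℕ} {Ω : Type*} [m : MeasurableSpace Ω] (Pr : Measure Ω)
    [IsProbabilityMeasure Pr] (ℱ : Filtration ℕ m)
    (c : GMM.Params) (hc : c.Feasible)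
    (f : EuclideanSpace ℝ (Fin d) → ℝ) (hf : GMM.StronglyConvexSmooth c.μ c.L f)
    (xstar : EuclideanSpace ℝ (Fin d)) (hxstar : ∀ x, f xstar ≤ f x)
    (x₀ : EuclideanSpace ℝ (Fin d))
    (σ : ℝ) (hσ : 0 < σ) (w : ℕ → Ω → EuclideanSpace ℝ (Fin d))
    (hw : GMM.SubGaussianNoise Pr ℱ σ w)
    (K : ℕ) (hK : 1 ≤ K) (θ : ℝ) (hθ : 0 < θ) :
    (0 ≤ c.lamPlus ∧ c.lamPlus < 1) ∧ (0 < c.J ∧ c.J ≤ 1) ∧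
    GMM.riskCost Pr σ
        (fun ω => GMM.cumSubopt f xstar
          (GMM.iterate c.α c.β c.ν f x₀ (fun k => w k ω)) K) K θ
      ≤ c.riskBound σ (c.V f xstar (x₀, x₀)) K θ := by
  refine ⟨⟨hc.lamPlus_nonneg, hc.lamPlus_lt_one⟩, ⟨hc.J_pos, hc.J_le_one⟩, ?_⟩
  unfold GMM.Params.riskBound
  split_ifs with hH
  swap
  · exact le_top
  have hrec := fun ω => GMM.V_state_succ_le hc hf hxstar x₀ (fun k => w k ω)
  have hnonneg : ∀ ω k,
      0 ≤ c.V f xstar (GMM.state c.α c.β c.ν f x₀ (fun k => w k ω) k) :=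
    fun ω k => hc.V_nonneg hf hxstar _ _
  have hsub : ∀ ω, c.lyapConst * GMM.cumSubopt f xstar
      (GMM.iterate c.α c.β c.ν f x₀ (fun k => w k ω)) K ≤
      ∑ k ∈ Finset.range (K + 1), c.V f xstar (GMM.state c.α c.β c.ν f x₀ (fun k => w k ω) k) := by
    intro ω
    rw [GMM.cumSubopt, Finset.mul_sum]
    exact Finset.sum_le_sum fun k _ => hc.lyapConst_mul_subopt_le_V hf hxstar _ _
  rcases min_choice (((1 / c.J : ℝ) : EReal) * c.cBar σ (c.V f xstar (x₀, x₀)) K (θ / c.J))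
    (c.cBar σ (c.V f xstar (x₀, x₀)) (K + 1) θ) with h | h <;> rw [h]
  · have := hc.riskCost_le_of_le_pathBound (V₀ := c.V f xstar (x₀, x₀)) hσ hw
      (one_div_pos.2 hc.J_pos) hθ K K fun ω =>
      (hsub ω).trans (hc.sum_le_pathBound_div (hnonneg ω) (hrec ω) K)
    rwa [one_div_mul_eq_div] at this
  · have := hc.riskCost_le_of_le_pathBound (V₀ := c.V f xstar (x₀, x₀)) hσ hw
      one_pos hθ K (K + 1) fun ω =>
      (hsub ω).trans ((hc.sum_le_pathBound_succ (hnonneg ω) (hrec ω) K).trans_eq (one_mul _).symm)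
    rwa [EReal.coe_one, one_mul, one_mul] at this
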